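/- Let $\pi$ be a finitely generated (not necessarily abelian) group, and let $\varphi\colon \pi\to\pi$ be an injective group homomorphism with $[\pi:\operatorname{im}\varphi]>1$ (the index is not assumed to be finite). Let $G:=\bigcap_{k=1}^{\infty}\operatorname{im}\varphi^{k}$, where $\varphi^k$ denotes the $k$-fold composition of $\varphi$ with itself, and suppose that $G$ is a normal subgroup of $\pi$ and that $\pi/G$ is abelian. Then $\pi/G\cong\mathbb{Z}^{n}$ for some integer $n>0$, the index $[\pi:\operatorname{im}\varphi]$ is finite, and the abelianization $G/[G,G]$ is a finitely generated group. -/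

import Mathlib

/-- The `k`-fold composite `φ ∘ ⋯ ∘ φ` of an endomorphism of a group, with underlying map `φ^[k]`. -/
def groupEndIterate {π : Type*} [Group π] (φ : π →* π) (k : ℕ) : π →* π where
  toFun := φ^[k]
  map_one' := iterate_map_one φ k
  map_mul' := iterate_map_mul φ k

/-- The subgroup `⋂_{k ≥ 1} im φ^k` of `π`. -/
def iterateRangeInter {π : Type*} [Group π] (φ : π →* π) : Subgroup π :=
  ⨅ k : ℕ, ⨅ _ : 1 ≤ k, (groupEndIterate φ k).range

/-! Put A = π/G and M = G/[G,G]. The map φ induces an injective endomorphism f of A whose iterated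
images meet trivially. Since f permutes the finite torsion subgroup, torsion lies in every image and
vanishes: A is free, and the cokernel of f is finite.

Conjugation makes M a finitely generated ℤ[A]-module, and φ restricts to an automorphism of G, so M
has an automorphism ψ semilinear over f. Let S be the image of ℤ[A] in End M, with endomorphism σ
given by conjugation by ψ. If each a in A acts as a root of unity modulo every minimal prime P of S,
then S is integral, hence finite, over ℤ (`finite_int_of_equivariant`). After passing to powers, σ
fixes P; the induced endomorphism τ of the residue field is surjective because ψ is.

The crux is `exists_nsmul_mem_ker_of_equivariant`, for the character χ : A → κ(P)ˣ. Integer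
characters of κ(P)ˣ pull back to a sublattice of Hom(A, ℤ) that f* maps onto itself, so the
characteristic polynomial q of f* there has constant term ±1. Every integer character kills
χ(q(f)a), which is therefore algebraic over the fixed field of τ and so τ-periodic. Hence χ kills
the image of (f^N - 1)q(f) for some N > 0. This map is injective because its constant term is a
unit, so its image has finite index. -/

section

open Polynomial TensorProduct

/-! ### Injective endomorphisms of abelian groups -/

/-- An integer polynomial in `φ` with invertible constant coefficient is injective as soon as
the ranges of the powers of `φ` have trivial intersection. -/
theorem aeval_injective_of_isUnit_coeff_zero {A : Type*} [AddCommGroup A] (φ : Module.End ℤ A)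
    (hφ : ⨅ k : ℕ, LinearMap.range (φ ^ k) = ⊥) {q : ℤ[X]} (hq : IsUnit (q.coeff 0)) :
    Function.Injective (aeval φ q) := by
  rw [← LinearMap.ker_eq_bot, eq_bot_iff, ← hφ]
  refine le_iInf fun k => ?_
  have hcomm : ∀ (p : ℤ[X]) (x : A), aeval φ p (φ x) = φ (aeval φ p x) := fun p x => by
    have : aeval φ (p * X) = aeval φ (X * p) := by rw [mul_comm]
    simpa using LinearMap.congr_fun this x
  -- Writing q = X·`q.divX` + u with u a unit, q(φ)x = 0 solves for x as a value of φ on the kernel;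
  -- so φ maps the kernel onto itself, and the kernel lies in every range.
  have key : ∀ x ∈ LinearMap.ker (aeval φ q), ∃ y ∈ LinearMap.ker (aeval φ q), φ y = x := by
    intro x hx
    rw [LinearMap.mem_ker] at hx
    obtain ⟨u, hu⟩ := hq
    refine ⟨-((↑u⁻¹ : ℤ) • aeval φ q.divX x), ?_, ?_⟩
    · have h1 : aeval φ q (aeval φ q.divX x) = aeval φ q.divX (aeval φ q x) := by
        rw [← Module.End.mul_apply, ← map_mul, mul_comm, map_mul, Module.End.mul_apply]
      rw [LinearMap.mem_ker, map_neg, map_zsmul, h1, hx]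
      simp
    · have h2 : φ (aeval φ q.divX x) + (u : ℤ) • x = 0 := by
        have h3 := hx
        rw [← divX_mul_X_add q, map_add, map_mul, aeval_X, aeval_C, ← hu] at h3
        simpa [hcomm] using h3
      rw [map_neg, map_zsmul, eq_neg_of_add_eq_zero_left h2, smul_neg, neg_neg, smul_smul,
        Units.inv_mul, one_smul]
  induction k with
  | zero => intro x _; exact ⟨x, by simp⟩
  | succ k ih =>
    intro x hx
    obtain ⟨y, hy, rfl⟩ := key x hx
    obtain ⟨z, rfl⟩ := ih hy
    exact ⟨z, by rw [pow_succ']; rfl⟩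

/-- The cokernel of an injective endomorphism of a finitely generated abelian group is torsion. -/
theorem exists_nsmul_mem_range_of_injective {A : Type*} [AddCommGroup A] [Module.Finite ℤ A]
    (β : Module.End ℤ A) (hβ : Function.Injective β) (a : A) :
    ∃ N : ℕ, 0 < N ∧ N • a ∈ LinearMap.range β := by
  have h := Submodule.finrank_quotient_add_finrank (LinearMap.range β)
  rw [LinearMap.finrank_range_of_inj hβ] at h
  have h0 : Module.finrank ℤ (A ⧸ LinearMap.range β) = 0 := by omega
  rw [Module.finrank_eq_zero_iff_isTorsion] at h0
  obtain ⟨⟨c, hc⟩, hca⟩ := @h0 (Submodule.Quotient.mk a)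
  refine ⟨c.natAbs, Int.natAbs_pos.mpr (nonZeroDivisors.ne_zero hc), ?_⟩
  have hca' : c • a ∈ LinearMap.range β := by
    rw [← Submodule.Quotient.mk_eq_zero]
    simpa using hca
  rcases Int.natAbs_eq c with h | h
  · rw [h, natCast_zsmul] at hca'; exact hca'
  · rw [h, neg_smul, natCast_zsmul] at hca'; exact neg_mem_iff.mp hca'

theorem finite_quotient_range_of_injective {A : Type*} [AddCommGroup A] [Module.Finite ℤ A]
    (β : Module.End ℤ A) (hβ : Function.Injective β) : Finite (A ⧸ LinearMap.range β) := by
  refine Module.finite_of_fg_torsion _ fun {x} => ?_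
  obtain ⟨a, rfl⟩ := Submodule.Quotient.mk_surjective _ x
  obtain ⟨N, hN, hNa⟩ := exists_nsmul_mem_range_of_injective β hβ a
  refine ⟨⟨N, mem_nonZeroDivisors_of_ne_zero (by exact_mod_cast hN.ne')⟩, ?_⟩
  rw [Submonoid.smul_def, natCast_zsmul, ← Submodule.Quotient.mk_smul]
  exact (Submodule.Quotient.mk_eq_zero _).mpr hNa

/-! ### Fields: semilinear maps, characters, periodicity -/

/-- A field endomorphism admitting a surjective semilinear endomorphism of a nonzero
finite-dimensional vector space is surjective. -/
theorem surjective_of_semilinear_surjective {F W : Type*} [Field F] [AddCommGroup W] [Module F W]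
    [Module.Finite F W] [Nontrivial W] (τ : F →+* F) (Ψ : W →ₛₗ[τ] W)
    (hΨ : Function.Surjective Ψ) : Function.Surjective τ := by
  let b := Module.finBasis F W
  set r := Module.finrank F W with hr
  have hr0 : 0 < r := Module.finrank_pos
  have hspan : Submodule.span τ.fieldRange (Set.range fun i => Ψ (b i)) = ⊤ := by
    rw [eq_top_iff]
    rintro w -
    obtain ⟨v, rfl⟩ := hΨ w
    rw [← b.sum_repr v, map_sum]
    refine Submodule.sum_mem _ fun i _ => ?_
    rw [LinearMap.map_smulₛₗ]
    exact Submodule.smul_mem _ (⟨τ (b.repr v i), by simp⟩ : τ.fieldRange)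
      (Submodule.subset_span ⟨i, rfl⟩)
  have hfinW : Module.Finite τ.fieldRange W :=
    Module.finite_def.mpr ⟨(Set.finite_range _).toFinset, by simpa using hspan⟩
  have hle : Module.finrank τ.fieldRange W ≤ r := by
    have := finrank_range_le_card (R := τ.fieldRange) (fun i => Ψ (b i))
    rw [Set.finrank, hspan, finrank_top] at this
    simpa using this
  have hfinF : Module.Finite τ.fieldRange F := by
    obtain ⟨w, hw⟩ := exists_ne (0 : W)
    exact Module.Finite.of_injective
      ((LinearMap.toSpanSingleton F W w).restrictScalars τ.fieldRange)
      (smul_left_injective F hw)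
  -- The images of a basis span W over τ(F), so [F : τ(F)]·r ≤ r, forcing degree 1.
  have hmul := Module.finrank_mul_finrank τ.fieldRange F W
  have h1 : Module.finrank τ.fieldRange F = 1 := by
    have hpos : 0 < Module.finrank τ.fieldRange F := Module.finrank_pos
    rw [← hr] at hmul
    nlinarith
  intro c
  obtain ⟨d, hd⟩ := (finrank_eq_one_iff_of_nonzero' (1 : F) one_ne_zero).mp h1 c
  obtain ⟨e, he⟩ := d.2
  exact ⟨e, by rw [← hd, he, Subfield.smul_def, smul_eq_mul, mul_one]⟩

/-- In a finitely generated field extension `F / k`, every element transcendental over `k` is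
detected by an integer-valued character of `Fˣ`. -/
theorem exists_hom_int_ne_zero_of_transcendental {k F : Type*} [Field k] [Field F] [Algebra k F]
    [Algebra.EssFiniteType k F] (t : Fˣ) (ht : Transcendental k (t : F)) :
    ∃ f : Additive Fˣ →ₗ[ℤ] ℤ, f (Additive.ofMul t) ≠ 0 := by
  have hind : AlgebraicIndepOn k id {(t : F)} :=
    (algebraicIndependent_singleton_iff (⟨(t : F), rfl⟩ : ({(t : F)} : Set F))).mpr ht
  obtain ⟨s, hts, hs⟩ := exists_isTranscendenceBasis_superset hind
  rw [Set.singleton_subset_iff] at hts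
  let k' := IntermediateField.adjoin k (s \ {(t : F)})
  have htk' : Transcendental k' (t : F) := by
    have h := hs.1.transcendental_adjoin (s := {j : s | (j : F) ≠ t}) (i := ⟨t, hts⟩) (by simp)
    have himg : ((↑) : s → F) '' {j : s | (j : F) ≠ t} = s \ {(t : F)} := by
      ext x; simp [and_comm]
    rw [himg] at h
    exact fun h' => h (IntermediateField.isAlgebraic_adjoin_iff.mp h')
  let E := IntermediateField.adjoin k' {(t : F)}
  have hE : E.restrictScalars k = IntermediateField.adjoin k s := by
    rw [IntermediateField.adjoin_adjoin_left, Set.sdiff_union_self, Set.union_eq_left.mpr]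
    simpa using hts
  have halg : Algebra.IsAlgebraic E F := by
    have h := hs.isAlgebraic_field
    rw [Subtype.range_coe, ← hE] at h
    exact h
  have hess : Algebra.EssFiniteType E F :=
    have : Algebra.EssFiniteType k' F := .of_comp k _ _
    .of_comp k' _ _
  have hfin : Module.Finite E F := Algebra.finite_of_essFiniteType_of_isAlgebraic
  -- The character is the degree in t of the norm to E = k'(t), over which F is finite; at t it
  -- equals [F : E].
  let e := RatFunc.algEquivOfTranscendental (t : F) htk'
  let g : Fˣ →* Multiplicative ℤ :=
    { toFun := fun u => Multiplicative.ofAdd (RatFunc.intDegree (e.symm (Algebra.norm E (u : F))))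
      map_one' := by simp
      map_mul' := fun u v => by
        rw [Units.val_mul, map_mul, map_mul, RatFunc.intDegree_mul, ofAdd_add]
        · exact (map_ne_zero e.symm).mpr (Units.map (Algebra.norm E) u).ne_zero
        · exact (map_ne_zero e.symm).mpr (Units.map (Algebra.norm E) v).ne_zero }
  refine ⟨(MonoidHom.toAdditiveLeft g).toIntLinearMap, ?_⟩
  have hdeg : ∀ n : ℕ, RatFunc.intDegree ((RatFunc.X : RatFunc k') ^ n) = n := fun n => by
    rw [← RatFunc.algebraMap_X, ← map_pow, RatFunc.intDegree_polynomial, natDegree_X_pow]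
  have hnorm : Algebra.norm E (t : F) =
      IntermediateField.AdjoinSimple.gen k' (t : F) ^ Module.finrank E F := by
    rw [← Algebra.norm_algebraMap]
    rfl
  have hg : RatFunc.intDegree (e.symm (Algebra.norm E (t : F))) = Module.finrank E F := by
    rw [hnorm, map_pow, RatFunc.algEquivOfTranscendental_symm_gen, hdeg]
  change RatFunc.intDegree (e.symm (Algebra.norm E (t : F))) ≠ 0
  rw [hg]
  exact_mod_cast (Module.finrank_pos (R := E) (M := F)).ne'

/-- An algebraic element is periodic under every endomorphism of an extension field. -/
theorem exists_iterate_eq_of_isAlgebraic {k F : Type*} [Field k] [Field F] [Algebra k F]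
    (τ : F →ₐ[k] F) {u : F} (hu : IsAlgebraic k u) : ∃ N : ℕ, 0 < N ∧ τ^[N] u = u := by
  obtain ⟨p, hp, hpu⟩ := hu
  have hmem : ∀ j : ℕ, τ^[j] u ∈ p.rootSet F := fun j => by
    rw [mem_rootSet]
    refine ⟨hp, ?_⟩
    induction j with
    | zero => exact hpu
    | succ j ih => rw [Function.iterate_succ_apply', aeval_algHom_apply, ih, map_zero]
  have hni : ¬ Function.Injective fun j : ℕ => (⟨τ^[j] u, hmem j⟩ : p.rootSet F) := fun hinj =>
    Infinite.not_finite (Finite.of_injective _ hinj)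
  simp only [Function.Injective, not_forall, Subtype.mk.injEq] at hni
  obtain ⟨i, j, hij, hne⟩ := hni
  have key : ∀ i j : ℕ, i < j → τ^[i] u = τ^[j] u → ∃ N : ℕ, 0 < N ∧ τ^[N] u = u := by
    intro i j h hij
    refine ⟨j - i, by omega, ?_⟩
    have hinj : Function.Injective τ := τ.toRingHom.injective
    apply hinj.iterate i
    rw [← Function.iterate_add_apply, Nat.add_sub_cancel' h.le, hij]
  rcases lt_or_gt_of_ne hne with h | h
  · exact key i j h hij
  · exact key j i h hij.symm

/-! ### Equivariant characters -/

/-- An endomorphism `T` of a finite free abelian group mapping a subgroup onto itself is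
annihilated on that subgroup by a polynomial with invertible constant coefficient. -/
theorem exists_aeval_eq_zero_of_map_eq {H : Type*} [AddCommGroup H] [Module.Finite ℤ H]
    [Module.Free ℤ H] (T : Module.End ℤ H) (Λ : Submodule ℤ H) (hΛ : Λ.map T = Λ) :
    ∃ q : ℤ[X], IsUnit (q.coeff 0) ∧ ∀ x ∈ Λ, aeval T q x = 0 := by
  have hmaps : ∀ x ∈ Λ, T x ∈ Λ := fun x hx => hΛ ▸ Submodule.mem_map_of_mem hx
  let T' : Module.End ℤ Λ := T.restrict hmaps
  have hsurj : Function.Surjective T' := by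
    rintro ⟨y, hy⟩
    rw [← hΛ] at hy
    obtain ⟨x, hx, rfl⟩ := hy
    exact ⟨⟨x, hx⟩, rfl⟩
  have hdet : IsUnit (LinearMap.det T') :=
    (LinearEquiv.ofBijective T' ⟨OrzechProperty.injective_of_surjective_endomorphism T' hsurj,
      hsurj⟩).isUnit_det'
  refine ⟨T'.charpoly, ?_, fun x hx => ?_⟩
  · rw [LinearMap.det_eq_sign_charpoly_coeff] at hdet
    exact isUnit_of_mul_isUnit_right hdet
  · have hcompat : ∀ (q : ℤ[X]) (y : Λ), ((aeval T' q y : Λ) : H) = aeval T q y := by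
      intro q y
      induction q using Polynomial.induction_on' with
      | add p q hp hq => simp [hp, hq]
      | monomial n a =>
        have hpow : ((T' ^ n) y : H) = (T ^ n) y := by
          induction n with
          | zero => rfl
          | succ n ih =>
            rw [pow_succ', pow_succ', Module.End.mul_apply, Module.End.mul_apply, ← ih]
            rfl
        simp [aeval_monomial, hpow]
    rw [← hcompat _ ⟨x, hx⟩, T'.aeval_self_charpoly]
    rfl

/-- A multiplicative character from a finite free abelian group to a finitely generated field,
equivariant for an endomorphism whose iterated images intersect trivially and an automorphism of
the field, has torsion image. -/
theorem exists_nsmul_mem_ker_of_equivariant {A F : Type*} [AddCommGroup A] [Module.Finite ℤ A]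
    [Module.Free ℤ A] (φ : Module.End ℤ A) (hφ : ⨅ k : ℕ, LinearMap.range (φ ^ k) = ⊥)
    [Field F] [Algebra.EssFiniteType ℤ F] (τ : F →+* F) (hτ : Function.Surjective τ)
    (χ : A →ₗ[ℤ] Additive Fˣ)
    (h : ∀ a, (((χ (φ a)).toMul : Fˣ) : F) = τ ((χ a).toMul : Fˣ)) (a : A) :
    ∃ N : ℕ, 0 < N ∧ N • a ∈ LinearMap.ker χ := by
  let e : F ≃+* F := RingEquiv.ofBijective τ ⟨τ.injective, hτ⟩
  let e' : Additive Fˣ ≃ₗ[ℤ] Additive Fˣ :=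
    (MulEquiv.toAdditive (Units.mapEquiv (e : F ≃* F))).toIntLinearEquiv
  have he' : ∀ a, χ (φ a) = e' (χ a) := fun a => Additive.toMul.injective (Units.ext (h a))
  let T : Module.End ℤ (A →ₗ[ℤ] ℤ) := LinearMap.lcomp ℤ ℤ φ
  let Λ : Submodule ℤ (A →ₗ[ℤ] ℤ) := LinearMap.range (LinearMap.lcomp ℤ ℤ χ)
  -- Both inclusions precompose characters with `e'` or its inverse; this is where surjectivity of τ
  -- enters.
  have hΛ : Λ.map T = Λ := by
    apply le_antisymm
    · rintro _ ⟨_, ⟨f, rfl⟩, rfl⟩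
      exact ⟨f ∘ₗ e', LinearMap.ext fun a => by simp [T, he']⟩
    · rintro _ ⟨f, rfl⟩
      exact ⟨_, ⟨f ∘ₗ e'.symm, rfl⟩, LinearMap.ext fun a => by simp [T, he']⟩
  obtain ⟨q, hq0, hq⟩ := exists_aeval_eq_zero_of_map_eq T Λ hΛ
  have hTq : ∀ (p : ℤ[X]) (f : A →ₗ[ℤ] ℤ) (a : A), aeval T p f a = f (aeval φ p a) := by
    intro p f a
    induction p using Polynomial.induction_on' with
    | add p q hp hq => simp [hp, hq]
    | monomial n c =>
      have hpow : ∀ f : A →ₗ[ℤ] ℤ, (T ^ n) f a = f ((φ ^ n) a) := by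
        induction n with
        | zero => exact fun f => rfl
        | succ n ih =>
          intro f
          rw [pow_succ, pow_succ', Module.End.mul_apply, Module.End.mul_apply, ih]
          rfl
      simp [aeval_monomial, hpow]
  let k : Subfield F := RingHom.eqLocusField τ (RingHom.id F)
  have : Algebra.EssFiniteType k F := .of_comp ℤ k F
  let τ' : F →ₐ[k] F := { τ with commutes' := fun x => x.2 }
  have halg : ∀ a, IsAlgebraic k (((χ (aeval φ q a)).toMul : Fˣ) : F) := by
    intro a
    by_contra hcon
    obtain ⟨f, hf⟩ := exists_hom_int_ne_zero_of_transcendental (k := k) _ hcon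
    apply hf
    have := LinearMap.congr_fun (hq _ ⟨f, rfl⟩) a
    rwa [hTq] at this
  have hiter : ∀ (n : ℕ) (a : A), (((χ ((φ ^ n) a)).toMul : Fˣ) : F) = τ^[n] ((χ a).toMul : Fˣ) := by
    intro n a
    induction n with
    | zero => rfl
    | succ n ih => rw [pow_succ', Module.End.mul_apply, h, ih, Function.iterate_succ_apply']
  have hper : ∀ a, ∃ N : ℕ, 0 < N ∧ χ ((φ ^ N) (aeval φ q a)) = χ (aeval φ q a) := by
    intro a
    obtain ⟨N, hN, hNa⟩ := exists_iterate_eq_of_isAlgebraic τ' (halg a)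
    exact ⟨N, hN, Additive.toMul.injective (Units.ext ((hiter N _).trans hNa))⟩
  choose n hn hnq using hper
  obtain ⟨s, hs⟩ := Module.Finite.fg_top (R := ℤ) (M := A)
  -- A common multiple of the periods at finitely many generators.
  let N := ∏ a ∈ s, n a
  have hN : 0 < N := Finset.prod_pos fun a _ => hn a
  have hχN : ∀ a, χ ((φ ^ N) (aeval φ q a)) = χ (aeval φ q a) := by
    have : χ ∘ₗ (φ ^ N) ∘ₗ aeval φ q = χ ∘ₗ aeval φ q := by
      refine LinearMap.ext_on hs fun a ha => ?_
      obtain ⟨m, hm⟩ := Finset.dvd_prod_of_mem n ha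
      change χ ((φ ^ N) (aeval φ q a)) = χ (aeval φ q a)
      have hm' : N = n a * m := hm
      apply Additive.toMul.injective
      apply Units.ext
      rw [hiter, hm', Function.iterate_mul]
      exact Function.iterate_fixed (by rw [← hiter, hnq]) m
    exact LinearMap.congr_fun this
  let β := aeval φ ((X ^ N - 1) * q)
  have hβ : Function.Injective β := by
    refine aeval_injective_of_isUnit_coeff_zero φ hφ ?_
    rw [mul_coeff_zero, coeff_sub, coeff_X_pow, if_neg hN.ne, coeff_one_zero, zero_sub]
    simpa using hq0
  obtain ⟨M, hM, b, hb⟩ := exists_nsmul_mem_range_of_injective β hβ a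
  refine ⟨M, hM, ?_⟩
  rw [← hb, LinearMap.mem_ker]
  simp [β, hχN]

/-! ### Residue fields at minimal primes -/

/-- Enlarging P by s strictly enlarges its contraction, by integrality. This lets denominators in
the residue field be chosen in the image of σ. -/
theorem RingHom.IsIntegral.exists_sub_mul_mem {R S : Type*} [CommRing R] [CommRing S] {σ : R →+* S}
    (hσ : σ.IsIntegral) (P : Ideal S) [P.IsPrime] {s : S} (hs : s ∉ P) :
    ∃ t : R, σ t ∉ P ∧ ∃ u : S, σ t - u * s ∈ P := by
  let _ := σ.toAlgebra
  have hlt := Ideal.comap_lt_comap_of_integral_mem_sdiff (R := R) (I := P)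
    (J := P ⊔ Ideal.span {s}) le_sup_left
    ⟨Ideal.mem_sup_right (Ideal.mem_span_singleton_self s), hs⟩ (hσ s)
  obtain ⟨t, ht, htP⟩ := SetLike.exists_of_lt hlt
  refine ⟨t, htP, ?_⟩
  obtain ⟨p, hp, z, hz, hpz⟩ := Submodule.mem_sup.mp ht
  obtain ⟨u, rfl⟩ := Ideal.mem_span_singleton'.mp hz
  refine ⟨u, ?_⟩
  have : σ t = p + u * s := hpz.symm
  rwa [this, add_sub_cancel_right]

/-- If a finite module carries a surjective semilinear endomorphism over an integral ring
endomorphism fixing a prime of its support, then the induced endomorphism of the residue field is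
surjective. -/
theorem residueFieldMap_surjective_of_semilinear {S M : Type*} [CommRing S] [AddCommGroup M]
    [Module S M] [Module.Finite S M] (σ : S →+* S) (hσ : σ.IsIntegral) (ψ : M →ₛₗ[σ] M)
    (hψ : Function.Surjective ψ) (P : Ideal S) [P.IsPrime] (hP : P = P.comap σ)
    (hann : Module.annihilator S M ≤ P) :
    Function.Surjective (Ideal.ResidueField.map P P σ hP) := by
  let τ := Ideal.ResidueField.map P P σ hP
  have hτ : ∀ s, τ (algebraMap S _ s) = algebraMap S _ (σ s) :=
    Ideal.ResidueField.map_algebraMap P P σ hP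
  have : Nontrivial (P.ResidueField ⊗[S] M) := by
    rw [← Module.mem_support_iff_nontrivial_residueField_tensorProduct (p := ⟨P, inferInstance⟩),
      Module.mem_support_iff_of_finite]
    exact hann
  let τ' : P.ResidueField →ₛₗ[σ] P.ResidueField :=
    { toFun := τ
      map_add' := map_add τ
      map_smul' := fun s x => by rw [Algebra.smul_def, map_mul, hτ, Algebra.smul_def] }
  let Ψ : P.ResidueField ⊗[S] M →ₛₗ[τ] P.ResidueField ⊗[S] M :=
    { toFun := TensorProduct.map τ' ψ
      map_add' := map_add _
      map_smul' := fun c x => by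
        induction x with
        | zero => simp
        | add x y hx hy => simp only [smul_add, map_add, hx, hy]
        | tmul x m =>
          rw [TensorProduct.smul_tmul', TensorProduct.map_tmul, TensorProduct.map_tmul,
            TensorProduct.smul_tmul']
          congr 1
          exact map_mul τ c x }
  have hΨ : ∀ x m, Ψ (x ⊗ₜ m) = τ x ⊗ₜ ψ m := fun x m => rfl
  refine surjective_of_semilinear_surjective τ Ψ fun w => ?_
  induction w with
  | zero => exact ⟨0, map_zero Ψ⟩
  | add x y hx hy =>
    obtain ⟨x, rfl⟩ := hx
    obtain ⟨y, rfl⟩ := hy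
    exact ⟨x + y, map_add Ψ x y⟩
  | tmul f m =>
    obtain ⟨x, s, hs, hf⟩ : ∃ x s : S, s ∉ P ∧ f * algebraMap S _ s = algebraMap S _ x := by
      obtain ⟨⟨x, s⟩, h⟩ := IsLocalization.surj (nonZeroDivisors (S ⧸ P)) f
      obtain ⟨x, rfl⟩ := Ideal.Quotient.mk_surjective x
      obtain ⟨s, hs⟩ := s
      obtain ⟨s, rfl⟩ := Ideal.Quotient.mk_surjective s
      refine ⟨x, s, fun h => nonZeroDivisors.ne_zero hs (Ideal.Quotient.eq_zero_iff_mem.mpr h), ?_⟩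
      simpa using h
    obtain ⟨t, ht, u, hu⟩ := hσ.exists_sub_mul_mem P hs
    rw [← Ideal.algebraMap_residueField_eq_zero, map_sub, map_mul, sub_eq_zero] at hu
    have ht0 : algebraMap S P.ResidueField (σ t) ≠ 0 :=
      fun h => ht (Ideal.algebraMap_residueField_eq_zero.mp h)
    have hf' : f = (algebraMap S P.ResidueField (σ t))⁻¹ * algebraMap S _ (x * u) := by
      rw [eq_inv_mul_iff_mul_eq₀ ht0, hu, map_mul, ← hf]
      ring
    obtain ⟨m', hm'⟩ := hψ ((x * u) • m)
    refine ⟨(algebraMap S P.ResidueField t)⁻¹ ⊗ₜ m', ?_⟩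
    rw [hΨ, hm', map_inv₀, hτ, ← TensorProduct.smul_tmul, hf', Algebra.smul_def, mul_comm]

/-- For injective σ, every minimal prime is the contraction of a minimal prime. Choosing one gives
an injective self-map of a finite set, whose points are all periodic. -/
theorem exists_pos_comap_pow_eq_of_mem_minimalPrimes {S : Type*} [CommRing S] [IsNoetherianRing S]
    {σ : S →+* S} (hσ : Function.Injective σ) {P : Ideal S} (hP : P ∈ minimalPrimes S) :
    ∃ N : ℕ, 0 < N ∧ P = P.comap (σ ^ N) := by
  have hfin : Finite (minimalPrimes S) := (minimalPrimes.finite_of_isNoetherianRing S).to_subtype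
  have hex : ∀ Q : minimalPrimes S, ∃ Q' : minimalPrimes S, Ideal.comap σ Q' = (Q : Ideal S) := by
    rintro ⟨Q, hQ⟩
    obtain ⟨Q', hQ', h⟩ := Ideal.exists_minimalPrimes_comap_eq (I := ⊥) σ Q
      (by rwa [Ideal.comap_bot_of_injective σ hσ])
    exact ⟨⟨Q', hQ'⟩, h⟩
  choose g hg using hex
  have hginj : Function.Injective g := fun Q Q' h => Subtype.ext (by rw [← hg Q, h, hg])
  have hiter : ∀ (n : ℕ) (Q : minimalPrimes S), Ideal.comap (σ ^ n) (g^[n] Q) = (Q : Ideal S) := by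
    intro n
    induction n with
    | zero => exact fun Q => Ideal.comap_id _
    | succ n ih =>
      intro Q
      rw [pow_succ', Function.iterate_succ_apply', RingHom.mul_def, ← Ideal.comap_comap, hg, ih]
  obtain ⟨N, hN, hNP⟩ := hginj.mem_periodicPts ⟨P, hP⟩
  refine ⟨N, hN, ?_⟩
  have := hiter N ⟨P, hP⟩
  rw [hNP] at this
  exact this.symm

/-! ### Finiteness of the acting ring and of the module -/

/-- The cokernel of φ is torsion, so a positive power of each generator of S lies in the image of σ.
-/
theorem isIntegral_of_equivariant {A S : Type*} [AddCommGroup A] [Module.Finite ℤ A] [CommRing S]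
    (φ : Module.End ℤ A) (hφ : Function.Injective φ) (σ : S →+* S) (ρ : A →ₗ[ℤ] Additive Sˣ)
    (h : ∀ a, (((ρ (φ a)).toMul : Sˣ) : S) = σ ((ρ a).toMul : Sˣ))
    (hρ : Algebra.adjoin ℤ (Set.range fun a => (((ρ a).toMul : Sˣ) : S)) = ⊤) :
    σ.IsIntegral := by
  let _ := σ.toAlgebra
  intro s
  have hs : s ∈ Algebra.adjoin ℤ (Set.range fun a => (((ρ a).toMul : Sˣ) : S)) := hρ ▸ trivial
  induction hs using Algebra.adjoin_induction with
  | mem x hx =>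
    obtain ⟨a, rfl⟩ := hx
    obtain ⟨N, hN, b, hb⟩ := exists_nsmul_mem_range_of_injective φ hφ a
    refine IsIntegral.of_pow hN ?_
    have : (((ρ a).toMul : Sˣ) : S) ^ N = σ ((ρ b).toMul : Sˣ) := by
      rw [← h, hb, map_nsmul, toMul_nsmul, Units.val_pow_eq_pow_val]
    rw [this]
    exact σ.isIntegralElem_map
  | algebraMap n =>
    rw [eq_intCast, ← map_intCast σ]
    exact σ.isIntegralElem_map
  | add x y _ _ hx hy => exact RingHom.IsIntegralElem.add σ hx hy
  | mul x y _ _ hx hy => exact RingHom.IsIntegralElem.mul σ hx hy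

theorem finite_int_of_equivariant {A S M : Type*} [AddCommGroup A] [Module.Finite ℤ A]
    [Module.Free ℤ A] (φ : Module.End ℤ A) (hφ : ⨅ k : ℕ, LinearMap.range (φ ^ k) = ⊥)
    (hinj : Function.Injective φ) [CommRing S] [AddCommGroup M] [Module S M] [Module.Finite S M]
    (hM : Module.annihilator S M = ⊥) (σ : S →+* S) (hσ : Function.Injective σ)
    (ψ : AddMonoid.End M) (hψ : Function.Surjective ψ) (hψσ : ∀ s m, ψ (s • m) = σ s • ψ m)
    (ρ : A →ₗ[ℤ] Additive Sˣ)
    (h : ∀ a, (((ρ (φ a)).toMul : Sˣ) : S) = σ ((ρ a).toMul : Sˣ))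
    (hρ : Algebra.adjoin ℤ (Set.range fun a => (((ρ a).toMul : Sˣ) : S)) = ⊤) :
    Module.Finite ℤ S := by
  have hft : Algebra.FiniteType ℤ S := by
    have : AddGroup.FG A := Module.Finite.iff_addGroup_fg.mp inferInstance
    have : AddMonoid.FG A := AddGroup.fg_iff_addMonoid_fg.mp this
    let f : Multiplicative A →* S :=
      (Units.coeHom S).comp (AddMonoidHom.toMultiplicativeLeft ρ.toAddMonoidHom)
    refine Algebra.FiniteType.of_surjective (AddMonoidAlgebra.lift ℤ S A f) ?_
    rw [← AlgHom.range_eq_top, eq_top_iff, ← hρ, Algebra.adjoin_le_iff]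
    rintro _ ⟨a, rfl⟩
    exact ⟨AddMonoidAlgebra.single a 1, by simp [f]⟩
  have hnoeth : IsNoetherianRing S := Algebra.FiniteType.isNoetherianRing ℤ S
  have key : ∀ P ∈ minimalPrimes S, ∀ a, ∃ N : ℕ, 0 < N ∧ (((ρ a).toMul : Sˣ) : S) ^ N - 1 ∈ P := by
    intro P hP a
    have : P.IsPrime := hP.1.1
    obtain ⟨N, hN, hPN⟩ := exists_pos_comap_pow_eq_of_mem_minimalPrimes hσ hP
    have hN' : ∀ a, (((ρ ((φ ^ N) a)).toMul : Sˣ) : S) = (σ ^ N) ((ρ a).toMul : Sˣ) := by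
      clear hN hPN
      induction N with
      | zero => exact fun a => rfl
      | succ N ih =>
        intro a
        rw [pow_succ', pow_succ', Module.End.mul_apply, h, ih]
        rfl
    have hψN : ∀ s m, (ψ ^ N) (s • m) = (σ ^ N) s • (ψ ^ N) m := by
      clear hN hPN hN'
      induction N with
      | zero => exact fun s m => rfl
      | succ N ih =>
        intro s m
        rw [pow_succ', pow_succ']
        change ψ ((ψ ^ N) (s • m)) = σ ((σ ^ N) s) • ψ ((ψ ^ N) m)
        rw [ih, hψσ]
    have hφN : ⨅ k : ℕ, LinearMap.range ((φ ^ N) ^ k) = ⊥ := by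
      rw [eq_bot_iff, ← hφ]
      refine le_iInf fun k => (iInf_le _ k).trans ?_
      rw [← pow_mul, ← Nat.sub_add_cancel (Nat.le_mul_of_pos_left k hN), add_comm, pow_add]
      exact LinearMap.range_comp_le_range _ _
    have hφNinj : Function.Injective (φ ^ N) := by
      rw [Module.End.coe_pow]; exact hinj.iterate N
    have hψNsurj : Function.Surjective (ψ ^ N) := by
      rw [AddMonoid.End.coe_pow]; exact hψ.iterate N
    have hint := isIntegral_of_equivariant (φ ^ N) hφNinj (σ ^ N) ρ hN' hρ
    let ψ' : M →ₛₗ[σ ^ N] M := { (ψ ^ N : AddMonoid.End M) with map_smul' := hψN }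
    have hsurj := residueFieldMap_surjective_of_semilinear (σ ^ N) hint ψ' hψNsurj P hPN
      (hM.le.trans bot_le)
    let ι : Additive Sˣ →ₗ[ℤ] Additive P.ResidueFieldˣ :=
      (MonoidHom.toAdditive
        (Units.map (algebraMap S P.ResidueField : S →* P.ResidueField))).toIntLinearMap
    have hess : @Algebra.EssFiniteType ℤ P.ResidueField _ _ (Ring.toIntAlgebra _) := by
      have hess' : Algebra.EssFiniteType ℤ P.ResidueField := .comp ℤ S _
      convert hess'
      exact Subsingleton.elim _ _
    obtain ⟨n, hn, hna⟩ := exists_nsmul_mem_ker_of_equivariant (φ ^ N) hφN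
      (Ideal.ResidueField.map P P (σ ^ N) hPN) hsurj (ι ∘ₗ ρ) (fun a => by
        change algebraMap S P.ResidueField _ = Ideal.ResidueField.map P P _ hPN (algebraMap S _ _)
        rw [Ideal.ResidueField.map_algebraMap, hN']) a
    refine ⟨n, hn, ?_⟩
    rw [← Ideal.algebraMap_residueField_eq_zero, map_sub, map_pow, map_one, sub_eq_zero]
    rw [LinearMap.mem_ker, map_nsmul] at hna
    exact congrArg Units.val (congrArg Additive.toMul hna)
  have hint : Algebra.IsIntegral ℤ S := by
    rw [← integralClosure_eq_top_iff, eq_top_iff, ← hρ, Algebra.adjoin_le_iff]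
    rintro _ ⟨a, rfl⟩
    obtain ⟨N, hN, hmem⟩ : ∃ N : ℕ, 0 < N ∧ ∀ P ∈ minimalPrimes S,
        (((ρ a).toMul : Sˣ) : S) ^ N - 1 ∈ P := by
      choose! n hn hna using fun P hP => key P hP a
      have hfin := minimalPrimes.finite_of_isNoetherianRing S
      refine ⟨∏ P ∈ hfin.toFinset, n P, Finset.prod_pos fun P hP => hn P (by simpa using hP),
        fun P hP => ?_⟩
      obtain ⟨m, hm⟩ := Finset.dvd_prod_of_mem n (hfin.mem_toFinset.mpr hP)
      rw [hm, pow_mul]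
      exact P.mem_of_dvd (sub_one_dvd_pow_sub_one _ m) (hna P hP)
    have hnil : (((ρ a).toMul : Sˣ) : S) ^ N - 1 ∈ nilradical S := by
      rw [nilradical, Ideal.zero_eq_bot, ← Ideal.sInf_minimalPrimes, Ideal.mem_sInf]
      exact fun {P} hP => hmem P hP
    obtain ⟨r, hr⟩ := mem_nilradical.mp hnil
    -- The element ρ(a)^N - 1 lies in all minimal primes, so it is nilpotent, which yields a monic
    -- equation.
    refine ⟨(X ^ N - 1) ^ r, (monic_X_pow_sub_C (1 : ℤ) hN.ne').pow r, ?_⟩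
    rw [← Polynomial.aeval_def]
    simpa using hr
  exact Algebra.IsIntegral.finite

end

open scoped IsMulCommutative in
/-- A module that is finitely generated over the group ring of a finitely generated free abelian
group `A`, with an automorphism semilinear over an endomorphism of `A` whose iterated images
intersect trivially, is finitely generated as an abelian group. -/
theorem finite_int_of_equivariant_action {A M : Type*} [AddCommGroup A] [Module.Finite ℤ A]
    [Module.Free ℤ A] (φ : Module.End ℤ A) (hφ : ⨅ k : ℕ, LinearMap.range (φ ^ k) = ⊥)
    (hinj : Function.Injective φ) [AddCommGroup M] (act : Multiplicative A →* Module.End ℤ M)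
    (ψ : M ≃ₗ[ℤ] M)
    (h : ∀ a m, ψ (act (Multiplicative.ofAdd a) m) = act (Multiplicative.ofAdd (φ a)) (ψ m))
    (s : Set M) (hs : s.Finite)
    (hgen : ∀ N : AddSubgroup M, s ⊆ N → (∀ a, ∀ m ∈ N, act a m ∈ N) → N = ⊤) :
    Module.Finite ℤ M := by
  let S := Algebra.adjoin ℤ (Set.range act)
  have : IsMulCommutative S := Algebra.isMulCommutative_adjoin ℤ (by
    rintro _ ⟨a, rfl⟩ _ ⟨b, rfl⟩
    rw [← map_mul, mul_comm, map_mul])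
  have hfin : Module.Finite S M := by
    refine Module.finite_def.mpr ⟨hs.toFinset, ?_⟩
    rw [hs.coe_toFinset]
    have := hgen (Submodule.span S s).toAddSubgroup Submodule.subset_span fun a m hm =>
      Submodule.smul_mem _ (⟨act a, Algebra.subset_adjoin ⟨a, rfl⟩⟩ : S) hm
    rwa [Submodule.toAddSubgroup_eq_top] at this
  have hann : Module.annihilator S M = ⊥ := by
    rw [eq_bot_iff]
    intro x hx
    rw [Module.mem_annihilator] at hx
    exact Subtype.ext (LinearMap.ext hx)
  have hconj : ∀ a, ψ.conjAlgEquiv ℤ (act (Multiplicative.ofAdd a)) =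
      act (Multiplicative.ofAdd (φ a)) := fun a => LinearMap.ext fun m => by
    simp [h]
  have hmem : ∀ x : S, ψ.conjAlgEquiv ℤ (x : Module.End ℤ M) ∈ S := by
    rintro ⟨x, hx⟩
    have : S ≤ S.comap (ψ.conjAlgEquiv ℤ).toAlgHom := by
      rw [Algebra.adjoin_le_iff]
      rintro _ ⟨a, rfl⟩
      exact Algebra.subset_adjoin ⟨_, (hconj a.toAdd).symm⟩
    exact this hx
  let σ : S →+* S := ((ψ.conjAlgEquiv ℤ).toAlgHom.toRingHom.comp S.val.toRingHom).codRestrict S hmem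
  let ρ₀ : Multiplicative A →* S := act.codRestrict S fun a => Algebra.subset_adjoin ⟨a, rfl⟩
  let ρ : A →ₗ[ℤ] Additive Sˣ := (MonoidHom.toAdditiveRight ρ₀.toHomUnits).toIntLinearMap
  have hS : Module.Finite ℤ S := by
    refine finite_int_of_equivariant φ hφ hinj (M := M) hann σ ?_ ψ.toAddEquiv.toAddMonoidHom
      ψ.surjective ?_ ρ ?_ ?_
    · intro x y hxy
      exact Subtype.ext ((ψ.conjAlgEquiv ℤ).injective (congrArg Subtype.val hxy))
    · rintro ⟨x, hx⟩ m
      change ψ (x m) = ψ (x (ψ.symm (ψ m)))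
      rw [ψ.symm_apply_apply]
    · intro a
      exact Subtype.ext (hconj a).symm
    · have hrange : (Set.range fun a => (((ρ a).toMul : Sˣ) : S)) =
          Subtype.val ⁻¹' Set.range act := by
        ext x
        constructor
        · rintro ⟨a, rfl⟩
          exact ⟨_, rfl⟩
        · rintro ⟨a, ha⟩
          exact ⟨a.toAdd, Subtype.ext ha⟩
      rw [hrange]
      convert Algebra.adjoin_adjoin_coe_preimage (R := ℤ) (s := Set.range act)
  have : IsScalarTower ℤ S M := inferInstance
  exact Module.Finite.trans S M

/-! ### Group theory of the quotient and of the abelianization -/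

/-- A finitely generated abelian group with an injective endomorphism whose iterated images
intersect trivially is free. -/
theorem free_int_of_iInf_range_pow_eq_bot {A : Type*} [AddCommGroup A] [Module.Finite ℤ A]
    (φ : Module.End ℤ A) (hφ : ⨅ k : ℕ, LinearMap.range (φ ^ k) = ⊥)
    (hinj : Function.Injective φ) : Module.Free ℤ A := by
  let T := Submodule.torsion ℤ A
  have hT : Finite T := Module.finite_of_fg_torsion T (Submodule.torsion_isTorsion)
  have hmaps : ∀ x ∈ T, φ x ∈ T := by
    rintro x ⟨c, hc⟩
    exact ⟨c, by rw [Submonoid.smul_def, ← map_smul, ← Submonoid.smul_def, hc, map_zero]⟩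
  have hsurj : Function.Surjective (φ.restrict hmaps) := by
    apply Finite.surjective_of_injective
    exact fun x y hxy => Subtype.ext (hinj (congrArg Subtype.val hxy))
  have hbot : T = ⊥ := by
    rw [eq_bot_iff, ← hφ]
    refine le_iInf fun k => ?_
    induction k with
    | zero => exact fun x _ => ⟨x, rfl⟩
    | succ k ih =>
      intro x hx
      obtain ⟨⟨y, hy⟩, hyx⟩ := hsurj ⟨x, hx⟩
      obtain ⟨z, rfl⟩ := ih hy
      exact ⟨z, by rw [pow_succ']; exact congrArg Subtype.val hyx⟩
  have : Module.IsTorsionFree ℤ A := Submodule.isTorsionFree_iff_torsion_eq_bot.mpr hbot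
  exact Module.free_of_finite_type_torsion_free'

theorem Subgroup.fg_of_commGroup {A : Type*} [CommGroup A] [Group.FG A] (H : Subgroup A) :
    H.FG := by
  have : Module.Finite ℤ (Additive A) := Module.Finite.iff_addGroup_fg.mpr inferInstance
  rw [Subgroup.fg_iff_add_fg, ← AddSubgroup.toIntSubmodule_toAddSubgroup (Subgroup.toAddSubgroup H),
    ← Submodule.fg_iff_addSubgroup_fg]
  exact IsNoetherian.noetherian _

open scoped commutatorElement in
/-- A normal subgroup with abelian quotient of a finitely generated group is the normal closure
of a finite set. -/
theorem exists_finite_normalClosure_eq {π : Type*} [Group π] [Group.FG π] (G : Subgroup π)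
    [G.Normal] (hab : ∀ x y : π ⧸ G, x * y = y * x) :
    ∃ T : Set π, T.Finite ∧ Subgroup.normalClosure T = G := by
  obtain ⟨s, hs⟩ := Group.fg_def.mp (inferInstance : Group.FG π)
  let C : Set π := Set.image2 (fun a b => ⁅a, b⁆) (s : Set π) s
  have hCfin : C.Finite := s.finite_toSet.image2 _ s.finite_toSet
  have hCG : C ⊆ G := by
    rintro _ ⟨a, -, b, -, rfl⟩
    rw [SetLike.mem_coe, ← QuotientGroup.eq_one_iff]
    change ((⁅a, b⁆ : π) : π ⧸ G) = 1
    rw [commutatorElement_def]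
    simp [hab (a : π ⧸ G) b]
  -- Commutators of generators already make π/K abelian, so the image of G in it is finitely
  -- generated; lifts of its generators complete C.
  let K := Subgroup.normalClosure C
  have hKcomm : ∀ x y : π ⧸ K, x * y = y * x := by
    have hgen : Subgroup.closure (QuotientGroup.mk' K '' s) = ⊤ := by
      rw [← MonoidHom.map_closure, hs, ← MonoidHom.range_eq_map, QuotientGroup.range_mk']
    have hcomm : ∀ x ∈ QuotientGroup.mk' K '' s, ∀ y ∈ QuotientGroup.mk' K '' s,
        x * y = y * x := by
      rintro _ ⟨a, ha, rfl⟩ _ ⟨b, hb, rfl⟩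
      rw [← commutatorElement_eq_one_iff_mul_comm, ← map_commutatorElement]
      exact (QuotientGroup.eq_one_iff _).mpr (Subgroup.subset_normalClosure ⟨a, ha, b, hb, rfl⟩)
    intro x y
    have hx : x ∈ Subgroup.closure (QuotientGroup.mk' K '' s) := hgen ▸ trivial
    have hy : y ∈ Subgroup.closure (QuotientGroup.mk' K '' s) := hgen ▸ trivial
    have := Subgroup.isMulCommutative_closure hcomm
    exact setLike_mul_comm hx hy
  let _ : CommGroup (π ⧸ K) := { (inferInstance : Group (π ⧸ K)) with mul_comm := hKcomm }
  obtain ⟨T₀, hT₀⟩ := Subgroup.fg_of_commGroup (G.map (QuotientGroup.mk' K))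
  have hlift : ∀ t ∈ T₀, ∃ g ∈ G, QuotientGroup.mk' K g = t := fun t ht => by
    have : t ∈ Subgroup.closure (T₀ : Set (π ⧸ K)) := Subgroup.subset_closure ht
    rwa [hT₀] at this
  choose! l hlG hl using hlift
  refine ⟨C ∪ l '' T₀, hCfin.union (T₀.finite_toSet.image l), le_antisymm ?_ ?_⟩
  · refine Subgroup.normalClosure_le_normal (Set.union_subset hCG ?_)
    rintro _ ⟨t, ht, rfl⟩
    exact hlG t ht
  · intro x hx
    have hmap : (Subgroup.closure (l '' T₀)).map (QuotientGroup.mk' K) =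
        G.map (QuotientGroup.mk' K) := by
      rw [← hT₀, MonoidHom.map_closure, Set.image_image]
      congr 1
      ext t
      constructor
      · rintro ⟨t, ht, rfl⟩
        simpa only [hl t ht] using ht
      · exact fun ht => ⟨t, ht, hl t ht⟩
    have hx' : QuotientGroup.mk' K x ∈ G.map (QuotientGroup.mk' K) := ⟨x, hx, rfl⟩
    rw [← hmap] at hx'
    obtain ⟨y, hy, hyx⟩ := hx'
    have hyK : y⁻¹ * x ∈ K := QuotientGroup.eq.mp hyx
    rw [← mul_inv_cancel_left y x]
    refine mul_mem ?_ (Subgroup.normalClosure_mono Set.subset_union_left hyK)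
    exact Subgroup.closure_le_normalClosure
      (Subgroup.closure_mono Set.subset_union_right hy)

/-- The action of `π / G` on the abelianization of a normal subgroup `G` by conjugation. -/
noncomputable def abelianizationConjAction {π : Type*} [Group π] (G : Subgroup π) [G.Normal] :
    π ⧸ G →* Module.End ℤ (Additive (Abelianization G)) :=
  QuotientGroup.lift G
    { toFun := fun g => (MonoidHom.toAdditive
        (Abelianization.map (MulAut.conjNormal g : MulAut G).toMonoidHom)).toIntLinearMap
      map_one' := LinearMap.ext fun m => by
        obtain ⟨x, hx⟩ := QuotientGroup.mk_surjective m.toMul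
        obtain rfl : Additive.ofMul (Abelianization.of x) = m := hx
        change Additive.ofMul (Abelianization.of (MulAut.conjNormal (1 : π) x)) = _
        rw [map_one]
        rfl
      map_mul' := fun g h => LinearMap.ext fun m => by
        obtain ⟨x, hx⟩ := QuotientGroup.mk_surjective m.toMul
        obtain rfl : Additive.ofMul (Abelianization.of x) = m := hx
        change Additive.ofMul (Abelianization.of (MulAut.conjNormal (g * h) x)) = _
        rw [map_mul]
        rfl }
    (fun g hg => LinearMap.ext fun m => by
      obtain ⟨x, hx⟩ := QuotientGroup.mk_surjective m.toMul
      obtain rfl : Additive.ofMul (Abelianization.of x) = m := hx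
      change Additive.ofMul (Abelianization.of (MulAut.conjNormal ((⟨g, hg⟩ : G) : π) x)) =
        Additive.ofMul (Abelianization.of x)
      refine congrArg Additive.ofMul ?_
      rw [MulAut.conjNormal_val, MulAut.conj_apply, map_mul, map_mul, map_inv, mul_comm,
        inv_mul_cancel_left])

theorem mem_iterateRangeInter_iff {π : Type*} [Group π] (φ : π →* π) (x : π) :
    x ∈ iterateRangeInter φ ↔ ∀ k : ℕ, ∃ y, φ^[k] y = x := by
  simp only [iterateRangeInter, Subgroup.mem_iInf, MonoidHom.mem_range]
  refine ⟨fun h k => ?_, fun h k _ => h k⟩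
  rcases Nat.eq_zero_or_pos k with rfl | hk
  · exact ⟨x, rfl⟩
  · exact h k hk

theorem map_mem_iterateRangeInter_iff {π : Type*} [Group π] (φ : π →* π)
    (hφ : Function.Injective φ) (x : π) :
    φ x ∈ iterateRangeInter φ ↔ x ∈ iterateRangeInter φ := by
  simp only [mem_iterateRangeInter_iff]
  constructor
  · intro h k
    obtain ⟨y, hy⟩ := h (k + 1)
    rw [Function.iterate_succ_apply'] at hy
    exact ⟨y, hφ hy⟩
  · intro h k
    obtain ⟨y, hy⟩ := h k
    exact ⟨φ y, by rw [← Function.iterate_succ_apply, Function.iterate_succ_apply', hy]⟩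

theorem iterateRangeInter_le_range {π : Type*} [Group π] (φ : π →* π) :
    iterateRangeInter φ ≤ φ.range := fun x hx => (mem_iterateRangeInter_iff φ x).mp hx 1

/-- A stable subgroup of the abelianization pulls back to a subgroup of G normal in π; if it
contains a finite set with normal closure G, it is all of G. -/
theorem exists_finite_generators_abelianization {π : Type*} [Group π] [Group.FG π]
    (G : Subgroup π) [G.Normal] (hab : ∀ x y : π ⧸ G, x * y = y * x) :
    ∃ s : Set (Additive (Abelianization G)), s.Finite ∧
      ∀ N : AddSubgroup (Additive (Abelianization G)), s ⊆ N →
        (∀ a, ∀ m ∈ N, abelianizationConjAction G a m ∈ N) → N = ⊤ := by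
  obtain ⟨T, hT, hTG⟩ := exists_finite_normalClosure_eq G hab
  let ι : G → Additive (Abelianization G) := fun x => Additive.ofMul (Abelianization.of x)
  refine ⟨ι '' (Subtype.val ⁻¹' T),
    (hT.preimage Subtype.val_injective.injOn).image ι, fun N hN hstable => ?_⟩
  let H : Subgroup G := (AddSubgroup.toSubgroup N).comap Abelianization.of
  have hH : ∀ x : G, x ∈ H ↔ ι x ∈ N := fun x => Iff.rfl
  have hnormal : (H.map G.subtype).Normal := by
    refine ⟨?_⟩
    rintro _ ⟨x, hx, rfl⟩ g
    exact ⟨MulAut.conjNormal g x, hstable g _ hx, MulAut.conjNormal_apply g x⟩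
  have hle : G ≤ H.map G.subtype := by
    conv_lhs => rw [← hTG]
    refine Subgroup.normalClosure_le_normal fun t ht => ?_
    have htG : t ∈ G := hTG ▸ Subgroup.subset_normalClosure ht
    exact ⟨⟨t, htG⟩, hN ⟨⟨t, htG⟩, ht, rfl⟩, rfl⟩
  rw [eq_top_iff]
  rintro m -
  obtain ⟨x, hx⟩ := QuotientGroup.mk_surjective m.toMul
  obtain ⟨y, hy, hyx⟩ := hle x.2
  have : y = x := Subtype.ext hyx
  subst this
  have := (hH y).mp hy
  rwa [show ι y = m from hx] at this

/-! ### Assembly -/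

theorem mainTheorem4 {π : Type*} [Group π] [Group.FG π] (φ : π →* π)
    (hφ : Function.Injective φ) (hindex : 1 < ENat.card (π ⧸ φ.range))
    (G : Subgroup π) (hG : G = iterateRangeInter φ)
    [G.Normal] (hab : ∀ x y : π ⧸ G, x * y = y * x) :
    (∃ n : ℕ, 0 < n ∧ Nonempty ((π ⧸ G) ≃* Multiplicative (Fin n → ℤ))) ∧
      φ.range.FiniteIndex ∧
      Group.FG (Abelianization G) := by
  have hmem : ∀ x, φ x ∈ G ↔ x ∈ G := by
    subst hG
    exact map_mem_iterateRangeInter_iff φ hφ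
  have hle : G ≤ φ.range := hG ▸ iterateRangeInter_le_range φ
  let _ : CommGroup (π ⧸ G) := { (inferInstance : Group (π ⧸ G)) with mul_comm := hab }
  let φ' : π ⧸ G →* π ⧸ G := QuotientGroup.map G G φ fun x hx => (hmem x).mpr hx
  have hφ' : Function.Injective φ' := by
    rw [injective_iff_map_eq_one]
    intro x hx
    obtain ⟨x, rfl⟩ := QuotientGroup.mk_surjective x
    rw [QuotientGroup.eq_one_iff, ← hmem]
    exact (QuotientGroup.eq_one_iff _).mp hx
  let f : Module.End ℤ (Additive (π ⧸ G)) := (MonoidHom.toAdditive φ').toIntLinearMap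
  have hf : Function.Injective f := hφ'
  have hfpow : ∀ (k : ℕ) (x : π), (f ^ k) (Additive.ofMul (x : π ⧸ G)) =
      Additive.ofMul ((φ^[k] x : π) : π ⧸ G) := by
    intro k x
    induction k with
    | zero => rfl
    | succ k ih =>
      rw [pow_succ', Module.End.mul_apply, ih, Function.iterate_succ_apply']
      rfl
  have hfinf : ⨅ k : ℕ, LinearMap.range (f ^ k) = ⊥ := by
    rw [eq_bot_iff]
    intro a ha
    obtain ⟨x, hx⟩ := QuotientGroup.mk_surjective a.toMul
    obtain rfl : Additive.ofMul (x : π ⧸ G) = a := hx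
    change (x : π ⧸ G) = 1
    rw [QuotientGroup.eq_one_iff, hG, mem_iterateRangeInter_iff]
    intro k
    obtain ⟨b, hb⟩ := (Submodule.mem_iInf _).mp ha k
    obtain ⟨y, hy⟩ := QuotientGroup.mk_surjective b.toMul
    obtain rfl : Additive.ofMul (y : π ⧸ G) = b := hy
    rw [hfpow] at hb
    have hyx : (φ^[k] y)⁻¹ * x ∈ G := QuotientGroup.eq.mp hb
    rw [hG, mem_iterateRangeInter_iff] at hyx
    obtain ⟨z, hz⟩ := hyx k
    -- Elements of G are themselves k-fold images, so the discrepancy in G can be absorbed into the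
    -- preimage.
    exact ⟨y * z, by rw [iterate_map_mul, hz, mul_inv_cancel_left]⟩
  have hfin : Module.Finite ℤ (Additive (π ⧸ G)) := Module.Finite.iff_addGroup_fg.mpr inferInstance
  have hfree := free_int_of_iInf_range_pow_eq_bot f hfinf hf
  refine ⟨⟨Module.finrank ℤ (Additive (π ⧸ G)), ?_, ⟨?_⟩⟩, ?_, ?_⟩
  · rw [Nat.pos_iff_ne_zero]
    intro h0
    have hsub : Subsingleton (Additive (π ⧸ G)) := Module.finrank_zero_iff.mp h0
    have htop : ∀ x, x ∈ φ.range := fun x =>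
      hle ((QuotientGroup.eq_one_iff x).mp (hsub.elim (x : π ⧸ G) (1 : π ⧸ G)))
    rw [ENat.one_lt_card_iff_nontrivial] at hindex
    obtain ⟨u, v, huv⟩ := hindex
    obtain ⟨u, rfl⟩ := QuotientGroup.mk_surjective u
    obtain ⟨v, rfl⟩ := QuotientGroup.mk_surjective v
    exact huv (QuotientGroup.eq.mpr (htop _))
  · exact AddEquiv.toMultiplicative
      (Module.finBasis ℤ (Additive (π ⧸ G))).equivFun.toAddEquiv
  · have hfinite := finite_quotient_range_of_injective f hf
    have hindex' : (Subgroup.toAddSubgroup φ'.range).FiniteIndex :=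
      AddSubgroup.finiteIndex_iff_finite_quotient.mpr hfinite
    rw [Subgroup.finiteIndex_toAddSubgroup_iff] at hindex'
    -- As G lies in the range of φ, the index can be computed in π/G.
    have hcomap : φ.range = φ'.range.comap (QuotientGroup.mk' G) := by
      ext x
      constructor
      · rintro ⟨y, rfl⟩
        exact ⟨(y : π ⧸ G), rfl⟩
      · rintro ⟨y, hy⟩
        obtain ⟨y, rfl⟩ := QuotientGroup.mk_surjective y
        have hyx : (φ y)⁻¹ * x ∈ G := QuotientGroup.eq.mp hy
        rw [← mul_inv_cancel_left (φ y) x]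
        exact mul_mem ⟨y, rfl⟩ (hle hyx)
    rw [Subgroup.finiteIndex_iff, hcomap,
      Subgroup.index_comap_of_surjective _ (QuotientGroup.mk'_surjective G)]
    exact hindex'.index_ne_zero
  · let ψ₀ : G →* G := (φ.comp G.subtype).codRestrict G fun x => (hmem x).mpr x.2
    have hψ₀ : Function.Bijective ψ₀ := by
      refine ⟨fun x y hxy => Subtype.ext (hφ (congrArg Subtype.val hxy)), fun y => ?_⟩
      obtain ⟨x, hx⟩ := hle y.2
      exact ⟨⟨x, (hmem x).mp (hx ▸ y.2)⟩, Subtype.ext hx⟩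
    let ψ : Additive (Abelianization G) ≃ₗ[ℤ] Additive (Abelianization G) :=
      (MulEquiv.toAdditive (MulEquiv.ofBijective ψ₀ hψ₀).abelianizationCongr).toIntLinearEquiv
    obtain ⟨s, hs, hgen⟩ := exists_finite_generators_abelianization G hab
    have hM := finite_int_of_equivariant_action f hfinf hf
      (abelianizationConjAction G) ψ (fun a m => by
        obtain ⟨g, hg⟩ := QuotientGroup.mk_surjective a.toMul
        obtain rfl : Additive.ofMul (g : π ⧸ G) = a := hg
        obtain ⟨x, hx⟩ := QuotientGroup.mk_surjective m.toMul
        obtain rfl : Additive.ofMul (Abelianization.of x) = m := hx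
        change Additive.ofMul (Abelianization.of (ψ₀ (MulAut.conjNormal g x))) =
          Additive.ofMul (Abelianization.of (MulAut.conjNormal (φ g) (ψ₀ x)))
        congr 2
        refine Subtype.ext ?_
        change φ (MulAut.conjNormal g x : G) = _
        rw [MulAut.conjNormal_apply, MulAut.conjNormal_apply, map_mul, map_mul, map_inv]
        rfl) s hs hgen
    rw [GroupFG.iff_add_fg]
    exact Module.Finite.iff_addGroup_fg.mp hM
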